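/- Let $G=(V,D,B)$ be a mixed graph: $V$ is a finite set, $D\subseteq V\times V$ is a set of directed edges $v\to w$, and $B\subseteq V\times V$ is a symmetric set of bidirected edges $v\leftrightarrow w$, with no self-loops in $D$ or $B$. Write $\mathrm{pa}(v)=\{w : w\to v\in D\}$ and $\mathrm{sib}(v)=\{w : w\leftrightarrow v\in B\}$. A half-trek from $y$ to $p$ is a path of the form $y=x_0\to x_1\to\cdots\to x_r=p$ or $y\leftrightarrow x_0\to x_1\to\cdots\to x_r=p$ with $r\ge 0$, where nodes may repeat; its left side is $\{y\}$ and its right side is $\{x_0,\dots,x_r\}$. A set $Y\subseteq V$ satisfies the half-trek criterion with respect to $v\in V$ if (i) $|Y|=|\mathrm{pa}(v)|$, (ii) $Y\cap(\{v\}\cup\mathrm{sib}(v))=\varnothing$, and (iii) there is a set of half-treks whose sources are pairwise distinct and form the set $Y$, whose targets are pairwise distinct and form the set $\mathrm{pa}(v)$, and which has no sided intersection, i.e. any two different half-treks in it have disjoint left sides and disjoint right sides. Let $\Theta$ be the set of pairs $(\Lambda,\Omega)$ of real $V\times V$ matrices such that $\lambda_{vw}=0$ whenever $v\to w\notin D$,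 $I-\Lambda$ is invertible, $\Omega$ is symmetric positive definite, and $\omega_{vw}=0$ whenever $v\ne w$ and $v\leftrightarrow w\notin B$. Let $\phi_G(\Lambda,\Omega)=(I-\Lambda)^{-T}\,\Omega\,(I-\Lambda)^{-1}$ on $\Theta$. Suppose that every family $(Y_v : v\in V)$ of subsets of $V$ either contains a set $Y_v$ that fails to satisfy the half-trek criterion with respect to $v$, or contains a pair of sets $(Y_v,Y_w)$ with $v\in Y_w$ and $w\in Y_v$. Then $\phi_G$ is generically infinite-to-one: there is a proper algebraic subset $Z\subsetneq\Theta$ (the set of points of $\Theta$ satisfying some system of polynomial equations in the entries of $\Lambda$ and $\Omega$) such that for every $(\Lambda,\Omega)\in\Theta\setminus Z$ the fiber $\{(\Lambda',\Omega')\in\Theta : \phi_G(\Lambda',\Omega')=\phi_G(\Lambda,\Omega)\}$ is infinite. -/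

import Mathlib

open scoped Matrix

/-- A mixed graph on the node set `V`: `dir v w` is the directed edge `v → w`, and
`bi.Adj v w` is the bidirected edge `v ↔ w` (symmetric). There are no self-loops of
either kind. -/
structure MixedGraph (V : Type*) where
  dir : V → V → Prop
  dir_irrefl : ∀ v, ¬ dir v v
  bi : SimpleGraph V

namespace MixedGraph

variable {V : Type*} (G : MixedGraph V)

/-- The parents of `v`: the nodes `w` with `w → v`. -/
def pa (v : V) : Set V := {w | G.dir w v}

/-- The siblings of `v`: the nodes `w` with `w ↔ v`. -/
def sib (v : V) : Set V := {w | G.bi.Adj w v}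

/-- A trek: two directed paths (not necessarily simple), each listed along the direction of its
edges, whose first nodes either coincide (the top node) or are joined by a bidirected edge. The
trek runs from the last node of the left path to the last node of the right path. -/
structure Trek where
  left : List V
  right : List V
  left_ne_nil : left ≠ []
  right_ne_nil : right ≠ []
  left_chain : left.IsChain G.dir
  right_chain : right.IsChain G.dir
  join : left.head left_ne_nil = right.head right_ne_nil ∨
    G.bi.Adj (left.head left_ne_nil) (right.head right_ne_nil)

namespace Trek

variable {G}

/-- The first node of a trek. -/
def source (π : G.Trek) : V := π.left.getLast π.left_ne_nil

/-- The last node of a trek. -/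
def target (π : G.Trek) : V := π.right.getLast π.right_ne_nil

/-- The set of nodes on the left-hand side; it contains the top node, if there is one. -/
def Left (π : G.Trek) : Set V := {v | v ∈ π.left}

/-- The set of nodes on the right-hand side; it contains the top node, if there is one. -/
def Right (π : G.Trek) : Set V := {v | v ∈ π.right}

/-- A half-trek is a trek whose left-hand side is a single node. -/
def IsHalfTrek (π : G.Trek) : Prop := π.Left.ncard = 1

end Trek

variable {G} in
/-- A set of treks is a system of treks from `X` to `Y` if the sources are distinct and form the
set `X`, and the targets are distinct and form the set `Y`. -/
structure IsTrekSystem (P : Set G.Trek) (X Y : Set V) : Prop where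
  source_injOn : Set.InjOn Trek.source P
  target_injOn : Set.InjOn Trek.target P
  image_source : Trek.source '' P = X
  image_target : Trek.target '' P = Y

variable {G} in
/-- No two distinct treks in the set share a node on their left-hand sides, nor on their
right-hand sides. -/
def NoSidedIntersection (P : Set G.Trek) : Prop :=
  ∀ π ∈ P, ∀ ρ ∈ P, π ≠ ρ → π.Left ∩ ρ.Left = ∅ ∧ π.Right ∩ ρ.Right = ∅

/-- The set `Y` satisfies the half-trek criterion with respect to the node `v`. -/
structure HalfTrekCriterion (Y : Set V) (v : V) : Prop where
  card_eq : Y.ncard = (G.pa v).ncard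
  inter_eq : Y ∩ ({v} ∪ G.sib v) = ∅
  exists_system : ∃ P : Set G.Trek, IsTrekSystem P Y (G.pa v) ∧
    (∀ π ∈ P, π.IsHalfTrek) ∧ NoSidedIntersection P

section Parametrization

variable [Fintype V] [DecidableEq V]

/-- The real matrices `Λ` supported on the directed edges, with `I - Λ` invertible. -/
def regMatrices : Set (Matrix V V ℝ) :=
  {Λ | (∀ v w, ¬ G.dir v w → Λ v w = 0) ∧ IsUnit (1 - Λ)}

/-- The (symmetric) positive definite real matrices whose off-diagonal entries are supported on
the bidirected edges. -/
def posDefMatrices : Set (Matrix V V ℝ) :=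
  {Ω | Ω.PosDef ∧ ∀ v w, v ≠ w → ¬ G.bi.Adj v w → Ω v w = 0}

/-- The parameter space `Θ`. -/
def paramSpace : Set (Matrix V V ℝ × Matrix V V ℝ) := G.regMatrices ×ˢ G.posDefMatrices

/-- The parametrization `(Λ, Ω) ↦ (I - Λ)⁻ᵀ Ω (I - Λ)⁻¹`, to be used on the parameter space. -/
noncomputable def param (θ : Matrix V V ℝ × Matrix V V ℝ) : Matrix V V ℝ :=
  ((1 - θ.1)⁻¹)ᵀ * θ.2 * (1 - θ.1)⁻¹

/-- The fiber of the parametrization through `θ`. -/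
def fiber (θ : Matrix V V ℝ × Matrix V V ℝ) : Set (Matrix V V ℝ × Matrix V V ℝ) :=
  {θ' ∈ G.paramSpace | param θ' = param θ}

end Parametrization

/-- The entries of a pair of matrices, as the values of polynomial variables. -/
def coords (θ : Matrix V V ℝ × Matrix V V ℝ) : (V × V) ⊕ (V × V) → ℝ :=
  Sum.elim (fun e => θ.1 e.1 e.2) (fun e => θ.2 e.1 e.2)

/-- `Z` is the subset of `T` cut out by polynomial equations in the entries of the matrices. -/
def IsAlgebraicSubset (Z T : Set (Matrix V V ℝ × Matrix V V ℝ)) : Prop :=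
  ∃ S : Set (MvPolynomial ((V × V) ⊕ (V × V)) ℝ),
    Z = {θ ∈ T | ∀ f ∈ S, MvPolynomial.eval (coords θ) f = 0}

/-- The parametrization is generically infinite-to-one: its fibers are infinite at all points of
the parameter space outside a proper algebraic subset. -/
def GenericallyInfiniteToOne [Fintype V] [DecidableEq V] : Prop :=
  ∃ Z : Set (Matrix V V ℝ × Matrix V V ℝ),
    IsAlgebraicSubset Z G.paramSpace ∧ Z ⊂ G.paramSpace ∧
      ∀ θ ∈ G.paramSpace \ Z, (G.fiber θ).Infinite

end MixedGraph

/-! Put `K = Ω (1 - Λ)⁻¹`. Up to invertible outer factors, the derivative of the parametrization in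
the direction `(Δ, Ω')` is `(K Δ)ᵀ + Ω' + K Δ`. A kernel direction thus has `Ω' = -(K Δ + (K Δ)ᵀ)`,
and the only constraint on `Δ` is that this matrix vanish at distinct non-siblings: a linear system
whose matrix is `equationMatrix K`.

That system is singular on all of `Θ`. Otherwise it has a nonzero maximal minor, and a Laplace
expansion with the columns grouped by the head `v` of the edge gives nonzero minors of `K` with
columns `pa v` and some row set `Y_v`. Each yields half-treks without sided intersection
(`halfTrekCriterion_of_det_ne_zero`), while `v ∈ Y_w` and `w ∈ Y_v` would use one equation twice.
Such a family contradicts the hypothesis.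

Where the kernel has minimal dimension the derivative has locally constant rank, so the fiber
contains a small slice of positive dimension (`infinite_fiber_of_finrank_ker_le`). Minimality can
fail only on the zero set of one polynomial (`exists_det_ne_zero_imp_finrank_ker_le`). -/

namespace MixedGraph

open Matrix

/-! ### Half-treks from nonvanishing minors -/

/-- If a permutation of `k ⊕ V` sends no element of `k` into `k`, then its cycles, cut at the
elements of `k`, give pairwise disjoint paths in `V`. -/
theorem exists_disjoint_paths_of_perm {k V : Type*} [Finite k] [Finite V]
    (σ : Equiv.Perm (k ⊕ V)) (h0 : ∀ a, ∃ x, σ (Sum.inl a) = Sum.inr x) :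
    ∃ (L : k → List V) (hne : ∀ a, L a ≠ []),
      (∀ a, σ (Sum.inl a) = Sum.inr ((L a).head (hne a))) ∧
      (∀ a, (L a).IsChain (fun x y => σ (Sum.inr x) = Sum.inr y ∧ x ≠ y)) ∧
      (∀ a, ∃ b, σ (Sum.inr ((L a).getLast (hne a))) = Sum.inl b) ∧
      ∀ a a' v, v ∈ L a → v ∈ L a' → a = a' := by
  classical
  -- By `h0` a return to `k` takes at least two steps. Twice the order of `σ` is such an exponent.
  have hex : ∀ a, ∃ n, ∃ b, (σ ^ (n + 2)) (Sum.inl a) = Sum.inl b := by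
    intro a
    obtain ⟨m, hm, hm1⟩ := (isOfFinOrder_of_finite σ).exists_pow_eq_one
    refine ⟨2 * m - 2, a, ?_⟩
    have : 2 * m - 2 + 2 = m + m := by omega
    rw [this, pow_add, hm1]
    rfl
  let N : k → ℕ := fun a => Nat.find (hex a)
  have hr : ∀ a i, i ≤ N a → ∃ x, (σ ^ (i + 1)) (Sum.inl a) = Sum.inr x := by
    intro a i hi
    rcases i with _ | i
    · simpa using h0 a
    · rcases h : (σ ^ (i + 1 + 1)) (Sum.inl a) with b | x
      · exact absurd ⟨b, h⟩ (Nat.find_min (hex a) (m := i) (by change i < N a; omega))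
      · exact ⟨x, rfl⟩
  -- Past the end of the path the value is an arbitrary node, so that `x` is total.
  have hr' : ∀ a i, ∃ x, i ≤ N a → (σ ^ (i + 1)) (Sum.inl a) = Sum.inr x := by
    intro a i
    by_cases hi : i ≤ N a
    · obtain ⟨x, hx⟩ := hr a i hi
      exact ⟨x, fun _ => hx⟩
    · exact ⟨(h0 a).choose, fun h => absurd h hi⟩
  choose x hx using hr'
  -- Cancelling `σ ^ (i + 1)` leaves `inl a = σ ^ (j - i) (inl a')`, whose right side lies in `V`
  -- unless `i = j`.
  have aux : ∀ a a' i j, i ≤ j → j ≤ N a' → x a i = x a' j → i ≤ N a → a = a' ∧ i = j := by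
    intro a a' i j hij hj h hi
    have h1 : (σ ^ (i + 1)) (Sum.inl a) = (σ ^ (i + 1)) ((σ ^ (j - i)) (Sum.inl a')) := by
      rw [← Equiv.Perm.mul_apply, ← pow_add, hx a i hi, h, ← hx a' j hj]
      congr 2
      omega
    have h2 := (σ ^ (i + 1)).injective h1
    rcases h3 : j - i with _ | t
    · rw [h3] at h2
      exact ⟨by simpa using h2, by omega⟩
    · rw [h3, hx a' t (by omega)] at h2
      simp at h2
  have step : ∀ a i, i + 1 ≤ N a → σ (Sum.inr (x a i)) = Sum.inr (x a (i + 1)) := by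
    intro a i hi
    rw [← hx a i (by omega), ← hx a (i + 1) hi, pow_succ' σ (i + 1)]
    rfl
  refine ⟨fun a => List.ofFn (fun i : Fin (N a + 1) => x a i), fun a => by simp, ?_, ?_, ?_, ?_⟩
  · intro a
    rw [List.head_ofFn]
    simpa using hx a 0 (by omega)
  · intro a
    rw [List.isChain_ofFn]
    intro i hi
    refine ⟨step a i (by omega), fun h => ?_⟩
    have := (aux a a i (i + 1) (by omega) (by omega) h (by omega)).2
    omega
  · intro a
    obtain ⟨b, hb⟩ := Nat.find_spec (hex a)
    refine ⟨b, ?_⟩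
    rw [List.getLast_ofFn]
    simp only [Nat.add_sub_cancel]
    rw [← hx a (N a) le_rfl, ← hb, pow_succ' σ (Nat.find (hex a) + 1)]
    rfl
  · intro a a' v hv hv'
    rw [List.mem_ofFn] at hv hv'
    obtain ⟨i, hi⟩ := hv
    obtain ⟨j, hj⟩ := hv'
    have h : x a i = x a' j := hi.trans hj.symm
    rcases le_total i.1 j.1 with hij | hij
    · exact (aux a a' i j hij (by omega) h (by omega)).1
    · exact (aux a' a j i hij (by omega) h.symm (by omega)).1.symm

variable {V : Type*} (G : MixedGraph V)

/-- A nonvanishing minor of `Ω (I - Λ)⁻¹` with columns `pa v` yields a system of half-treks without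
sided intersection, ending in `pa v`. -/
theorem halfTrekCriterion_of_det_ne_zero [Fintype V] [DecidableEq V] {Λ Ω : Matrix V V ℝ}
    (hΛ : ∀ v w, ¬ G.dir v w → Λ v w = 0) (hu : IsUnit (1 - Λ))
    (hΩ : ∀ v w, v ≠ w → ¬ G.bi.Adj v w → Ω v w = 0)
    {k : Type*} [Fintype k] [DecidableEq k] (y p : k → V)
    (hy : Function.Injective y) (hp : Function.Injective p) (v : V) (hpv : Set.range p = G.pa v)
    (hyv : ∀ a, y a ≠ v ∧ ¬ G.bi.Adj (y a) v)
    (hdet : ((Ω * (1 - Λ)⁻¹).submatrix y p).det ≠ 0) :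
    G.HalfTrekCriterion (Set.range y) v := by
  -- The Schur complement of `1 - Λ` in this bordered matrix is minus the given minor.
  have hbig : (fromBlocks (0 : Matrix k k ℝ) (Ω.submatrix y id)
      ((1 : Matrix V V ℝ).submatrix id p) (1 - Λ)).det ≠ 0 := by
    have hd : IsUnit (1 - Λ).det := (isUnit_iff_isUnit_det _).1 hu
    let _ := invertibleOfIsUnitDet _ hd
    rw [det_fromBlocks₂₂, invOf_eq_nonsing_inv, zero_sub, det_neg]
    refine mul_ne_zero hd.ne_zero (mul_ne_zero (pow_ne_zero _ (by norm_num)) ?_)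
    convert hdet using 2
    ext a b
    simp [mul_apply, one_apply]
  -- A nonzero Leibniz term: its entries from `Ω` start half-treks, those from `1 - Λ` are fixed
  -- points or directed edges, and those from the border end at parents.
  obtain ⟨σ, hσ⟩ : ∃ σ : Equiv.Perm (k ⊕ V), ∀ i, fromBlocks (0 : Matrix k k ℝ)
      (Ω.submatrix y id) ((1 : Matrix V V ℝ).submatrix id p) (1 - Λ) i (σ i) ≠ 0 := by
    by_contra! hcon
    apply hbig
    rw [← det_transpose, det_apply]
    refine Finset.sum_eq_zero fun σ _ => ?_
    obtain ⟨i, hi⟩ := hcon σ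
    rw [Finset.prod_eq_zero (Finset.mem_univ i) (by simpa using hi), smul_zero]
  obtain ⟨L, hne, hhead, hchain, hlast, hdisj⟩ := exists_disjoint_paths_of_perm σ (by
    intro a
    rcases h : σ (Sum.inl a) with b | x
    · exact absurd (by simp [h]) (hσ (Sum.inl a))
    · exact ⟨x, rfl⟩)
  have hdir : ∀ a, (L a).IsChain G.dir := by
    intro a
    refine (hchain a).imp ?_
    rintro x z ⟨h1, h2⟩
    by_contra hxz
    have := hσ (Sum.inr x)
    rw [h1] at this
    simp [h2, hΛ x z hxz] at this
  have hjoin : ∀ a, y a = (L a).head (hne a) ∨ G.bi.Adj (y a) ((L a).head (hne a)) := by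
    intro a
    by_contra! hcon
    have := hσ (Sum.inl a)
    rw [hhead] at this
    simp [hΩ _ _ hcon.1 hcon.2] at this
  choose b hb using hlast
  have hend : ∀ a, (L a).getLast (hne a) = p (b a) := by
    intro a
    by_contra hcon
    have := hσ (Sum.inr ((L a).getLast (hne a)))
    rw [hb] at this
    simp [hcon] at this
  have hbi : Function.Injective b := by
    intro a a' h
    refine hdisj a a' ((L a).getLast (hne a)) (List.getLast_mem _) ?_
    rw [hend, h, ← hend]
    exact List.getLast_mem _
  have hbs : Function.Surjective b := Finite.surjective_of_injective hbi
  let T : k → G.Trek := fun a =>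
    { left := [y a]
      right := L a
      left_ne_nil := by simp
      right_ne_nil := hne a
      left_chain := by simp
      right_chain := hdir a
      join := hjoin a }
  have hs : ∀ a, (T a).source = y a := fun a => rfl
  have ht : ∀ a, (T a).target = p (b a) := hend
  refine ⟨?_, ?_, Set.range T, ⟨?_, ?_, ?_, ?_⟩, ?_, ?_⟩
  · rw [← hpv, ← Set.image_univ, ← Set.image_univ, Set.ncard_image_of_injective _ hy,
      Set.ncard_image_of_injective _ hp]
  · rw [Set.eq_empty_iff_forall_notMem]
    rintro _ ⟨⟨a, rfl⟩, h | h⟩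
    · exact (hyv a).1 h
    · exact (hyv a).2 h
  · rintro _ ⟨a, rfl⟩ _ ⟨a', rfl⟩ h
    rw [hs, hs] at h
    rw [hy h]
  · rintro _ ⟨a, rfl⟩ _ ⟨a', rfl⟩ h
    rw [ht, ht] at h
    rw [hbi (hp h)]
  · rw [← Set.range_comp]
    rfl
  · rw [← Set.range_comp, ← hpv, ← hbs.range_comp p]
    congr 1
    exact funext ht
  · rintro _ ⟨a, rfl⟩
    have : (T a).Left = {y a} := by
      ext z
      simp [Trek.Left, T]
    rw [Trek.IsHalfTrek, this, Set.ncard_singleton]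
  · rintro _ ⟨a, rfl⟩ _ ⟨a', rfl⟩ h
    have haa : a ≠ a' := fun h' => h (by rw [h'])
    constructor
    · rw [Set.eq_empty_iff_forall_notMem]
      rintro z ⟨h1, h2⟩
      simp only [Trek.Left, T, List.mem_singleton, Set.mem_ofPred_eq] at h1 h2
      exact haa (hy (h1.symm.trans h2))
    · rw [Set.eq_empty_iff_forall_notMem]
      rintro z ⟨h1, h2⟩
      exact haa (hdisj a a' z h1 h2)

end MixedGraph

/-! ### Laplace expansion by column groups and maximal minors -/

namespace Matrix

/-- A nonsingular matrix whose columns are partitioned by `c` has nonsingular blocks, after a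
suitable permutation of its rows. -/
theorem exists_perm_det_block_ne_zero {ι κ : Type*} [Fintype ι] [DecidableEq ι] [DecidableEq κ]
    (c : ι → κ) {N : Matrix ι ι ℝ} (hN : N.det ≠ 0) :
    ∃ σ : Equiv.Perm ι, (of fun i j => if c i = c j then N (σ i) j else 0).det ≠ 0 := by
  by_contra! hcon
  -- Expanding this sum and substituting `ρ = σ * τ` gives `N.det` times the number of `τ`
  -- preserving `c`, which is positive because of the identity.
  have h1 : ∑ σ : Equiv.Perm ι, (Equiv.Perm.sign σ : ℝ) *
      (of fun i j => if c i = c j then N (σ i) j else 0).det = 0 :=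
    Finset.sum_eq_zero fun σ _ => by rw [hcon, mul_zero]
  have h2 : ∀ σ : Equiv.Perm ι, (Equiv.Perm.sign σ : ℝ) *
      (of fun i j => if c i = c j then N (σ i) j else 0).det =
      ∑ τ : Equiv.Perm ι, (Equiv.Perm.sign (σ * τ) : ℝ) *
        if (∀ i, c (τ i) = c i) then ∏ i, N ((σ * τ) i) i else 0 := by
    intro σ
    rw [det_apply', Finset.mul_sum]
    refine Finset.sum_congr rfl fun τ _ => ?_
    rw [Equiv.Perm.sign_mul, ← mul_assoc]
    push_cast
    congr 1
    by_cases h : ∀ i, c (τ i) = c i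
    · rw [if_pos h]
      exact Finset.prod_congr rfl fun i _ => by simp [h]
    · rw [if_neg h]
      push Not at h
      obtain ⟨i, hi⟩ := h
      exact Finset.prod_eq_zero (Finset.mem_univ i) (by simp [hi])
  have h3 : ∀ τ : Equiv.Perm ι, ∑ σ : Equiv.Perm ι, (Equiv.Perm.sign (σ * τ) : ℝ) *
      (if (∀ i, c (τ i) = c i) then ∏ i, N ((σ * τ) i) i else 0) =
      if (∀ i, c (τ i) = c i) then N.det else 0 := by
    intro τ
    split_ifs
    · rw [det_apply']
      exact Equiv.sum_comp (Equiv.mulRight τ)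
        (fun ρ : Equiv.Perm ι => (Equiv.Perm.sign ρ : ℝ) * ∏ i, N (ρ i) i)
    · simp
  rw [Finset.sum_congr rfl fun σ _ => h2 σ, Finset.sum_comm,
    Finset.sum_congr rfl fun τ _ => h3 τ, ← Finset.sum_filter, Finset.sum_const,
    nsmul_eq_mul, mul_eq_zero] at h1
  rcases h1 with h1 | h1
  · rw [Nat.cast_eq_zero, Finset.card_eq_zero] at h1
    have : (1 : Equiv.Perm ι) ∈ (∅ : Finset (Equiv.Perm ι)) := by
      rw [← h1]
      simp
    simp at this
  · exact hN h1

/-- The squared length of `A x` is the dot product of `x` with `Aᵀ A x`. -/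
theorem mulVec_eq_zero_of_transpose_mulVec_mulVec {m n : Type*} [Fintype m] [Fintype n]
    {A : Matrix m n ℝ} {x : n → ℝ} (hx : Aᵀ *ᵥ (A *ᵥ x) = 0) : A *ᵥ x = 0 := by
  rw [← dotProduct_self_eq_zero, dotProduct_mulVec, ← mulVec_transpose, hx, zero_dotProduct]

/-- A matrix with trivial kernel has a nonsingular square submatrix containing all columns. -/
theorem exists_submatrix_det_ne_zero {m n : Type*} [Fintype m] [Fintype n] [DecidableEq n]
    (A : Matrix m n ℝ) (hA : ∀ x, A *ᵥ x = 0 → x = 0) :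
    ∃ s : n → m, (A.submatrix s id).det ≠ 0 := by
  by_contra! hcon
  -- The rows of `Aᵀ A` are combinations of rows of `A`, so by multilinearity its determinant is a
  -- combination of maximal minors of `A`.
  have h1 : (Aᵀ * A).det = 0 := by
    have : Aᵀ * A = fun i => ∑ j, A j i • A j := by
      ext i k
      simp [mul_apply]
    have h2 := (detRowAlternating (R := ℝ) (n := n)).toMultilinearMap.map_sum
      (fun (i : n) (j : m) => A j i • A j)
    have h3 : (Aᵀ * A).det = ∑ r : n → m, detRowAlternating (fun i => A (r i) i • A (r i)) := by
      rw [this]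
      exact h2
    rw [h3]
    refine Finset.sum_eq_zero fun r _ => ?_
    rw [← AlternatingMap.coe_multilinearMap, MultilinearMap.map_smul_univ]
    have := hcon r
    simp only [AlternatingMap.coe_multilinearMap]
    rw [show detRowAlternating (fun i => A (r i)) = (A.submatrix r id).det from rfl, this, smul_zero]
  obtain ⟨x, hx, hx0⟩ := exists_mulVec_eq_zero_iff.2 h1
  exact hx (hA x (mulVec_eq_zero_of_transpose_mulVec_mulVec (by rw [mulVec_mulVec, hx0])))

end Matrix

/-! ### The linear system for kernel directions and its singularity -/

namespace MixedGraph

open Matrix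

variable {V : Type*} (G : MixedGraph V)

/-- The directed edges, as pairs of their tail and their head. -/
abbrev Edge : Type _ := {e : V × V // G.dir e.1 e.2}

noncomputable instance [Fintype V] : Fintype G.Edge := Fintype.ofFinite _

open Classical in
/-- The matrix of the linear map sending a matrix `Δ` supported on the directed edges to the
entries of `K * Δ + (K * Δ)ᵀ` at the pairs of distinct nodes that are not siblings. -/
noncomputable def equationMatrix {R : Type*} [CommRing R] (K : Matrix V V R) :
    Matrix (V × V) G.Edge R :=
  of fun e d => if e.1 ≠ e.2 ∧ ¬ G.bi.Adj e.1 e.2 then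
    (if d.1.2 = e.2 then K e.1 d.1.1 else 0) + (if d.1.2 = e.1 then K e.2 d.1.1 else 0) else 0

/-- Ordered pairs list each equation twice; this is what excludes `v ∈ Y_w` together with `w ∈ Y_v`.
-/
theorem equationMatrix_swap {R : Type*} [CommRing R] (K : Matrix V V R) (a b : V) :
    G.equationMatrix K (a, b) = G.equationMatrix K (b, a) := by
  ext d
  classical
  exact if_congr (by rw [G.bi.adj_comm, ne_comm]) (add_comm _ _) rfl

/-- Since `a ≠ b`, only one summand survives, so the columns with head `b` form a submatrix of `K`.
-/
theorem equationMatrix_apply {R : Type*} [CommRing R] (K : Matrix V V R) {a b : V}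
    (hab : a ≠ b) (hadj : ¬ G.bi.Adj a b) (d : G.Edge) (hd : d.1.2 = b) :
    G.equationMatrix K (a, b) d = K a d.1.1 := by
  subst hd
  simp [equationMatrix, hab, hadj, hab.symm]

/-- The half-trek condition forces the kernel of the equation matrix to be nontrivial at every point
of the parameter space. -/
theorem exists_equationMatrix_mulVec_eq_zero [Fintype V] [DecidableEq V]
    (h : ∀ Y : V → Set V,
      (∃ v, ¬ G.HalfTrekCriterion (Y v) v) ∨ (∃ v w, v ∈ Y w ∧ w ∈ Y v))
    {θ : Matrix V V ℝ × Matrix V V ℝ} (hθ : θ ∈ G.paramSpace) :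
    ∃ x, x ≠ 0 ∧ G.equationMatrix (θ.2 * (1 - θ.1)⁻¹) *ᵥ x = 0 := by
  obtain ⟨⟨hΛ, hu⟩, -, hΩ⟩ := hθ
  set K := θ.2 * (1 - θ.1)⁻¹ with hK
  set J := G.equationMatrix K with hJ
  by_contra! hcon
  obtain ⟨s, hs⟩ := exists_submatrix_det_ne_zero J fun x hx => by
    by_contra h0
    exact hcon x h0 hx
  obtain ⟨σ, hσ⟩ := exists_perm_det_block_ne_zero (fun d : G.Edge => d.1.2) hs
  set M : Matrix G.Edge G.Edge ℝ :=
    of fun i j => if i.1.2 = j.1.2 then J.submatrix s id (σ i) j else 0 with hM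
  have hinj : ∀ i j, J (s (σ i)) = J (s (σ j)) → i = j := by
    intro i j hij
    by_contra hne
    exact hs (det_zero_of_row_eq (fun h' => hne (σ.injective h')) hij)
  -- A nonzero row of the block of `v` is an equation for a pair containing `v`; `a` is the other
  -- node.
  have hy : ∀ i : G.Edge, ∃ a, (s (σ i) = (a, i.1.2) ∨ s (σ i) = (i.1.2, a)) ∧
      a ≠ i.1.2 ∧ ¬ G.bi.Adj a i.1.2 := by
    intro i
    obtain ⟨j, hj⟩ : ∃ j, M i j ≠ 0 := by
      by_contra! hz
      exact hσ (det_eq_zero_of_row_eq_zero i hz)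
    have hij : i.1.2 = j.1.2 := by
      by_contra hne
      exact hj (if_neg hne)
    have hj' : J (s (σ i)) j ≠ 0 := by
      simpa [hM, hij] using hj
    rcases hab : s (σ i) with ⟨a, b⟩
    rw [hab] at hj'
    have hal : a ≠ b ∧ ¬ G.bi.Adj a b := by
      by_contra hne
      exact hj' (if_neg hne)
    by_cases h2 : j.1.2 = b
    · refine ⟨a, Or.inl ?_, ?_⟩
      · rw [hij, h2]
      · rwa [hij, h2]
    · by_cases h1 : j.1.2 = a
      · refine ⟨b, Or.inr ?_, ?_⟩
        · rw [hij, h1]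
        · rw [hij, h1, G.bi.adj_comm]
          exact ⟨hal.1.symm, hal.2⟩
      · exact absurd (by simp [hJ, equationMatrix, h1, h2]) hj'
  choose y hyt hyne hyadj using hy
  have hrow : ∀ i, J (s (σ i)) = J (y i, i.1.2) := by
    intro i
    rcases hyt i with h' | h'
    · rw [h']
    · rw [h', hJ, equationMatrix_swap]
  -- A kernel vector of one block, extended by zero, would be a kernel vector of `M`.
  have hblock : ∀ v, (K.submatrix (fun i : {d : G.Edge // d.1.2 = v} => y i.1)
      (fun i : {d : G.Edge // d.1.2 = v} => i.1.1.1)).det ≠ 0 := by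
    intro v hv
    obtain ⟨x, hx, hx0⟩ := exists_mulVec_eq_zero_iff.2 hv
    refine hσ (exists_mulVec_eq_zero_iff.1
      ⟨fun d => if hd : d.1.2 = v then x ⟨d, hd⟩ else 0, ?_, ?_⟩)
    · intro hz
      apply hx
      ext ⟨d, hd⟩
      simpa [hd] using congrFun hz d
    · ext i
      have hsum : (M *ᵥ fun d => if hd : d.1.2 = v then x ⟨d, hd⟩ else 0) i =
          ∑ d : {d : G.Edge // d.1.2 = v}, M i d.1 * x d := by
        refine (Fintype.sum_of_injective Subtype.val Subtype.val_injective _ _ ?_ ?_).symm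
        · intro d hd
          have : ¬ d.1.2 = v := fun h' => hd ⟨⟨d, h'⟩, rfl⟩
          simp [this]
        · intro d
          simp [d.2]
      rw [hsum]
      by_cases hi : i.1.2 = v
      · refine Eq.trans ?_ (congrFun hx0 ⟨i, hi⟩)
        refine Finset.sum_congr rfl fun d _ => ?_
        have hd : i.1.2 = d.1.1.2 := hi.trans d.2.symm
        simp only [hM, of_apply, if_pos hd, submatrix_apply, id]
        rw [hrow, hJ, equationMatrix_apply _ _ (hyne i) (hyadj i) _ hd.symm]
      · refine Finset.sum_eq_zero fun d _ => ?_
        have hd : ¬ i.1.2 = d.1.1.2 := fun h' => hi (h'.trans d.2)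
        simp [hM, hd]
  rcases h (fun v => Set.range fun i : {d : G.Edge // d.1.2 = v} => y i.1) with
    ⟨v, hv⟩ | ⟨v, w, ⟨⟨i, rfl⟩, hi⟩, ⟨⟨j, rfl⟩, hj⟩⟩
  · refine hv (G.halfTrekCriterion_of_det_ne_zero hΛ hu hΩ _ _ ?_ ?_ v ?_ ?_ (hblock v))
    · rintro ⟨i, hi⟩ ⟨j, hj⟩ hij
      refine Subtype.ext (hinj i j ?_)
      rw [hrow, hrow, hi, hj]
      exact congrArg (fun a => J (a, v)) hij
    · rintro ⟨i, hi⟩ ⟨j, hj⟩ hij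
      exact Subtype.ext (Subtype.ext (Prod.ext hij (hi.trans hj.symm)))
    · ext w
      constructor
      · rintro ⟨⟨i, rfl⟩, rfl⟩
        exact i.2
      · intro hw
        exact ⟨⟨⟨(w, v), hw⟩, rfl⟩, rfl⟩
    · rintro ⟨i, rfl⟩
      exact ⟨hyne i, hyadj i⟩
  -- Both edges use the equation of the same pair, so they coincide, and then `y i` is the head of
  -- `i`.
  · change y i = j.1.2 at hi
    change y j = i.1.2 at hj
    have hij : i = j := by
      apply hinj
      rw [hrow, hrow, hi, hj, hJ, equationMatrix_swap]
    subst hij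
    exact hyne i hi

end MixedGraph

/-! ### Infinite fibers at points of minimal kernel dimension -/

open Filter Topology in
/-- If the kernel of the derivative of `f` has minimal dimension at `x` among the points near `x`,
and this dimension is positive, then the fiber of `f` through `x` is infinite near `x`. -/
theorem infinite_fiber_of_finrank_ker_le {E F : Type*} [NormedAddCommGroup E] [NormedSpace ℝ E]
    [FiniteDimensional ℝ E] [NormedAddCommGroup F] [NormedSpace ℝ F] [FiniteDimensional ℝ F]
    {f : E → F} {x : E} (hf : ContDiffAt ℝ 1 f x)
    (hrank : ∀ᶠ y in 𝓝 x, Module.finrank ℝ (LinearMap.ker (fderiv ℝ f x : E →ₗ[ℝ] F)) ≤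
      Module.finrank ℝ (LinearMap.ker (fderiv ℝ f y : E →ₗ[ℝ] F)))
    (hpos : LinearMap.ker (fderiv ℝ f x : E →ₗ[ℝ] F) ≠ ⊥)
    {U : Set E} (hU : U ∈ 𝓝 x) : {y ∈ U | f y = f x}.Infinite := by
  have : CompleteSpace E := FiniteDimensional.complete ℝ E
  set A : E →ₗ[ℝ] F := (fderiv ℝ f x : E →ₗ[ℝ] F) with hA
  set K := LinearMap.ker A with hK
  set R := LinearMap.range A with hR
  obtain ⟨π', hπ'⟩ := LinearMap.exists_extend (LinearMap.id : R →ₗ[ℝ] R)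
  obtain ⟨q', hq'⟩ := LinearMap.exists_extend (LinearMap.id : K →ₗ[ℝ] K)
  let π : F →L[ℝ] R := π'.toContinuousLinearMap
  let q : E →L[ℝ] K := q'.toContinuousLinearMap
  have hπ : ∀ r : R, π r = r := fun r => LinearMap.congr_fun hπ' r
  have hq : ∀ r : K, q r = r := fun r => LinearMap.congr_fun hq' r
  -- Projections onto the range and the kernel of the derivative at `x` make `Φ` a local
  -- diffeomorphism there.
  let Φ : E → R × K := fun y => (π (f y), q y)
  let DΦ : E → E →L[ℝ] R × K := fun y => (π.comp (fderiv ℝ f y)).prod q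
  have hΦC : ContDiffAt ℝ 1 Φ x := by
    refine ContDiffAt.prodMk ?_ q.contDiff.contDiffAt
    exact π.contDiff.contDiffAt.comp x hf
  have hdiff : ∀ᶠ y in 𝓝 x, DifferentiableAt ℝ f y := by
    filter_upwards [hf.eventually (by simp)] with y hy using hy.differentiableAt (by simp)
  have hΦd : ∀ y, DifferentiableAt ℝ f y → HasFDerivAt Φ (DΦ y) y := by
    intro y hy
    exact (π.hasFDerivAt.comp y hy.hasFDerivAt).prodMk q.hasFDerivAt
  have hker : LinearMap.ker (DΦ x : E →ₗ[ℝ] R × K) = ⊥ := by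
    rw [LinearMap.ker_eq_bot']
    intro e he
    have h1 : π (A e) = 0 := congrArg Prod.fst he
    have h2 : q e = 0 := congrArg Prod.snd he
    have h3 : A e = 0 := by
      have := hπ ⟨A e, LinearMap.mem_range_self A e⟩
      rw [h1] at this
      exact (congrArg Subtype.val this).symm
    have := hq ⟨e, h3⟩
    rw [h2] at this
    exact (congrArg Subtype.val this).symm
  have hdim : Module.finrank ℝ E = Module.finrank ℝ (R × K) := by
    rw [Module.finrank_prod]
    exact (LinearMap.finrank_range_add_finrank_ker A).symm
  let e : E ≃L[ℝ] R × K := (LinearEquiv.ofInjectiveOfFinrankEq (DΦ x : E →ₗ[ℝ] R × K)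
    (LinearMap.ker_eq_bot.1 hker) hdim).toContinuousLinearEquiv
  have he : HasFDerivAt Φ (e : E →L[ℝ] R × K) x := by
    have : (e : E →L[ℝ] R × K) = DΦ x := by
      ext1 v
      rfl
    rw [this]
    exact hΦd x hdiff.self_of_nhds
  let Ψ := hΦC.toOpenPartialHomeomorph Φ he one_ne_zero
  have hΨ : ∀ y, Ψ y = Φ y := fun y => rfl
  have hxs : x ∈ Ψ.source := hΦC.mem_toOpenPartialHomeomorph_source he one_ne_zero
  have hxt : Φ x ∈ Ψ.target := hΦC.image_mem_toOpenPartialHomeomorph_target he one_ne_zero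
  have hgx : Ψ.symm (Φ x) = x := Ψ.left_inv hxs
  have hgC : ContDiffAt ℝ 1 Ψ.symm (Φ x) := hΦC.to_localInverse he one_ne_zero
  have hgd : ∀ᶠ z in 𝓝 (Φ x), DifferentiableAt ℝ Ψ.symm z := by
    filter_upwards [hgC.eventually (by simp)] with y hy using hy.differentiableAt (by simp)
  have hgcont : Tendsto Ψ.symm (𝓝 (Φ x)) (𝓝 x) := by
    simpa [hgx] using hgC.continuousAt.tendsto
  have hinj : ∀ᶠ y in 𝓝 x, LinearMap.ker (DΦ y : E →ₗ[ℝ] R × K) = ⊥ := by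
    have hc : ContinuousAt DΦ x := by
      have h1 : ContinuousAt (fderiv ℝ f) x := hf.continuousAt_fderiv (by simp)
      have h2 : ContinuousAt (fun y => π.comp (fderiv ℝ f y)) x :=
        continuousAt_const.clm_comp h1
      exact (ContinuousLinearMap.prodₗᵢ (𝕜 := ℝ) (E := E) (F := R) (G := K)
        ℝ).continuous.continuousAt.comp (h2.prodMk continuousAt_const)
    have ho : IsOpen (Set.range ((↑) : (E ≃L[ℝ] R × K) → E →L[ℝ] R × K)) :=
      ContinuousLinearEquiv.isOpen
    have hm : DΦ x ∈ Set.range ((↑) : (E ≃L[ℝ] R × K) → E →L[ℝ] R × K) := ⟨e, by ext1 v; rfl⟩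
    filter_upwards [hc.preimage_mem_nhds (ho.mem_nhds hm)] with y hy
    obtain ⟨e', he'⟩ := hy
    rw [← he']
    exact LinearMap.ker_eq_bot.2 e'.injective
  -- Near `x`, `q` is injective on the kernel of `π ∘ Df`, so that kernel has dimension at most `dim
  -- K`. By `hrank` it cannot exceed the kernel of `Df` that it contains.
  have hgood : ∀ᶠ y in 𝓝 x, DifferentiableAt ℝ f y ∧ y ∈ U ∧
      ∀ v, π (fderiv ℝ f y v) = 0 → fderiv ℝ f y v = 0 := by
    filter_upwards [hdiff, hU, hinj, hrank] with y h1 h2 h3 h4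
    refine ⟨h1, h2, ?_⟩
    set B : E →ₗ[ℝ] F := (fderiv ℝ f y : E →ₗ[ℝ] F)
    set C : E →ₗ[ℝ] R := π.toLinearMap ∘ₗ B
    have hle : LinearMap.ker B ≤ LinearMap.ker C := LinearMap.ker_le_ker_comp _ _
    have hCK : Module.finrank ℝ (LinearMap.ker C) ≤ Module.finrank ℝ K := by
      refine LinearMap.finrank_le_finrank_of_injective
        (f := q.toLinearMap ∘ₗ (LinearMap.ker C).subtype) ?_
      rw [← LinearMap.ker_eq_bot, LinearMap.ker_eq_bot']
      rintro ⟨v, hv⟩ hv'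
      have : v ∈ LinearMap.ker (DΦ y : E →ₗ[ℝ] R × K) := Prod.ext hv hv'
      rw [h3, Submodule.mem_bot] at this
      exact Subtype.ext this
    have heq := Submodule.eq_of_le_of_finrank_le hle (hCK.trans h4)
    intro v hv
    change v ∈ LinearMap.ker B
    rw [heq]
    exact hv
  have hall : ∀ᶠ z in 𝓝 (Φ x), z ∈ Ψ.target ∧ DifferentiableAt ℝ Ψ.symm z ∧
      DifferentiableAt ℝ f (Ψ.symm z) ∧ Ψ.symm z ∈ U ∧
      ∀ v, π (fderiv ℝ f (Ψ.symm z) v) = 0 → fderiv ℝ f (Ψ.symm z) v = 0 := by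
    filter_upwards [Ψ.open_target.mem_nhds hxt, hgd, hgcont.eventually hgood] with z h1 h2 h3
    exact ⟨h1, h2, h3⟩
  let s : K → R × K := fun k => (π (f x), k)
  have hs : Tendsto s (𝓝 (q x)) (𝓝 (Φ x)) :=
    (Continuous.prodMk_right (π (f x))).tendsto (q x)
  obtain ⟨ε, hε, hball⟩ := Metric.eventually_nhds_iff_ball.1 (hs.eventually hall)
  let γ : K → E := fun k => Ψ.symm (s k)
  have hΦγ : ∀ k ∈ Metric.ball (q x) ε, Φ (γ k) = s k := fun k hk => Ψ.right_inv (hball k hk).1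
  -- Along the slice `γ` the function `π ∘ f` is constant, so by `hgood` the derivative of `f ∘ γ`
  -- vanishes.
  have hconst : ∀ k ∈ Metric.ball (q x) ε, f (γ k) = f x := by
    have hγd : ∀ k ∈ Metric.ball (q x) ε, DifferentiableAt ℝ γ k := fun k hk =>
      (hball k hk).2.1.comp k ((differentiableAt_const _).prodMk differentiableAt_id)
    intro k hk
    have h1 : f (γ k) = f (γ (q x)) := by
      refine Metric.isOpen_ball.is_const_of_fderiv_eq_zero (𝕜 := ℝ) (f := fun k => f (γ k))
        (convex_ball (q x) ε).isPreconnected ?_ ?_ hk (Metric.mem_ball_self hε)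
      · intro k hk
        exact ((hball k hk).2.2.1.comp k (hγd k hk)).differentiableWithinAt
      · intro k hk
        ext1 v
        have h2 : HasFDerivAt (fun k => f (γ k)) ((fderiv ℝ f (γ k)).comp (fderiv ℝ γ k)) k :=
          (hball k hk).2.2.1.hasFDerivAt.comp k (hγd k hk).hasFDerivAt
        have h3 := π.hasFDerivAt.comp k h2
        have h4 : HasFDerivAt (π ∘ fun k => f (γ k)) (0 : K →L[ℝ] R) k := by
          refine (hasFDerivAt_const (π (f x)) k).congr_of_eventuallyEq ?_
          filter_upwards [Metric.isOpen_ball.mem_nhds hk] with k' hk'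
          exact congrArg Prod.fst (hΦγ k' hk')
        rw [h2.fderiv]
        exact (hball k hk).2.2.2.2 _ (DFunLike.congr_fun (h3.unique h4) v)
    rw [h1]
    exact congrArg f hgx
  have hnt : Nontrivial K := Submodule.nontrivial_iff_ne_bot.2 hpos
  have hinf : (Metric.ball (q x) ε).Infinite :=
    infinite_of_mem_nhds (q x) (Metric.ball_mem_nhds _ hε)
  refine (hinf.image (f := γ) ?_).mono ?_
  · intro k hk k' hk' h
    have h1 := hΦγ k hk
    rw [h, hΦγ k' hk'] at h1
    exact (congrArg Prod.snd h1).symm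
  · rintro _ ⟨k, hk, rfl⟩
    exact ⟨(hball k hk).2.2.2.1, hconst k hk⟩

/-! ### Semicontinuity of kernels and openness of positive definiteness -/

namespace Matrix

/-- Polynomial certificate for the upper semicontinuity of the dimension of the kernel. -/
theorem exists_det_ne_zero_imp_finrank_ker_le {m n : Type*} [Fintype m] [Fintype n]
    [DecidableEq n] (A₀ : Matrix m n ℝ) :
    ∃ (B : Matrix n m ℝ) (C : Matrix n n ℝ), (B * A₀ + C).det ≠ 0 ∧
      ∀ A : Matrix m n ℝ, (B * A + C).det ≠ 0 →
        Module.finrank ℝ (LinearMap.ker A.mulVecLin) ≤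
          Module.finrank ℝ (LinearMap.ker A₀.mulVecLin) := by
  classical
  set K := LinearMap.ker A₀.mulVecLin with hK
  obtain ⟨p, hp⟩ := LinearMap.exists_extend (LinearMap.id : K →ₗ[ℝ] K)
  have hp' : ∀ x (hx : x ∈ K), p x = ⟨x, hx⟩ := fun x hx => LinearMap.congr_fun hp ⟨x, hx⟩
  have hC : ∀ x, LinearMap.toMatrix' (K.subtype ∘ₗ p) *ᵥ x = p x := fun x => by
    rw [LinearMap.toMatrix'_mulVec]
    rfl
  -- With `P` a projection onto `ker A₀`, a null vector `x` of `A₀ᵀ A₀ + P` satisfies `A₀ A₀ᵀ A₀ x =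
  -- 0`, hence `A₀ x = 0` and `x = P x = 0`. If `A₀ᵀ A + P` is nonsingular, `P` embeds `ker A` into
  -- `ker A₀`.
  refine ⟨A₀ᵀ, LinearMap.toMatrix' (K.subtype ∘ₗ p), fun h0 => ?_, fun A hA => ?_⟩
  · obtain ⟨x, hx, hx0⟩ := exists_mulVec_eq_zero_iff.2 h0
    rw [add_mulVec, hC, ← mulVec_mulVec] at hx0
    have h1 : A₀ᵀ *ᵥ (A₀ *ᵥ x) = 0 := by
      refine mulVec_eq_zero_of_transpose_mulVec_mulVec ?_
      rw [transpose_transpose, eq_neg_of_add_eq_zero_left hx0, mulVec_neg]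
      have : A₀ *ᵥ (p x : n → ℝ) = 0 := (p x).2
      rw [this, neg_zero]
    have h2 : x ∈ K := mulVec_eq_zero_of_transpose_mulVec_mulVec h1
    rw [h1, zero_add, hp' x h2] at hx0
    exact hx hx0
  · refine LinearMap.finrank_le_finrank_of_injective
      (f := p ∘ₗ (LinearMap.ker A.mulVecLin).subtype) ?_
    rw [← LinearMap.ker_eq_bot, LinearMap.ker_eq_bot']
    rintro ⟨x, hx⟩ hx'
    refine Subtype.ext ?_
    by_contra hne
    refine hA (exists_mulVec_eq_zero_iff.1 ⟨x, hne, ?_⟩)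
    have hx1 : A *ᵥ x = 0 := hx
    have hx2 : p x = 0 := hx'
    rw [add_mulVec, hC, ← mulVec_mulVec, hx1, mulVec_zero, hx2, zero_add]
    rfl

open Filter Topology in
/-- Positive definite matrices form an open subset of the symmetric matrices. -/
theorem PosDef.eventually_nhds {n : Type*} [Fintype n] {A₀ : Matrix n n ℝ} (hA₀ : A₀.PosDef) :
    ∀ᶠ A in 𝓝 A₀, A.IsHermitian → A.PosDef := by
  have hcont : Continuous fun z : Matrix n n ℝ × (n → ℝ) => z.2 ⬝ᵥ z.1 *ᵥ z.2 := by
    fun_prop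
  -- Compactness of the sphere gives one neighbourhood for all `x`; scaling does the rest.
  have hsph : ∀ᶠ A in 𝓝 A₀, ∀ x ∈ Metric.sphere (0 : n → ℝ) 1, 0 < x ⬝ᵥ A *ᵥ x := by
    refine (isCompact_sphere (0 : n → ℝ) 1).eventually_forall_of_forall_eventually ?_
    intro x hx
    refine hcont.continuousAt.eventually (lt_mem_nhds ?_)
    have hx0 : x ≠ 0 := by
      rintro rfl
      simp at hx
    simpa using hA₀.dotProduct_mulVec_pos hx0
  filter_upwards [hsph] with A hA hH
  refine PosDef.of_dotProduct_mulVec_pos hH fun x hx => ?_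
  have hn : 0 < ‖x‖ := norm_pos_iff.2 hx
  have h1 := hA (‖x‖⁻¹ • x) (by simp [norm_smul, hn.ne'])
  rw [mulVec_smul, dotProduct_smul, smul_dotProduct, smul_eq_mul, smul_eq_mul] at h1
  simpa using pos_of_mul_pos_right (pos_of_mul_pos_right h1 (by positivity)) (by positivity)

end Matrix

/-! ### The derivative of the parametrization -/

namespace MixedGraph

open Matrix
open scoped Matrix.Norms.Operator

variable {V : Type*} (G : MixedGraph V)

theorem equationMatrix_map {R S : Type*} [CommRing R] [CommRing S] (φ : R →+* S)
    (K : Matrix V V R) : (G.equationMatrix K).map φ = G.equationMatrix (K.map φ) := by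
  ext e d
  simp only [equationMatrix, map_apply, of_apply]
  split_ifs <;> simp

theorem equationMatrix_smul {R : Type*} [CommRing R] (c : R) (K : Matrix V V R) :
    G.equationMatrix (c • K) = c • G.equationMatrix K := by
  ext e d
  simp only [equationMatrix, Matrix.smul_apply, of_apply]
  split_ifs <;> simp [mul_add]

theorem equationMatrix_mulVec [Fintype V] {R : Type*} [CommRing R] (K Δ : Matrix V V R)
    (hΔ : ∀ v w, ¬ G.dir v w → Δ v w = 0) {a b : V} (hab : a ≠ b) (hadj : ¬ G.bi.Adj a b) :
    (G.equationMatrix K *ᵥ fun d => Δ d.1.1 d.1.2) (a, b) = (K * Δ) a b + (K * Δ) b a := by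
  classical
  have hsum : ∀ a b, ∑ d : G.Edge, (if d.1.2 = b then K a d.1.1 else 0) * Δ d.1.1 d.1.2 =
      (K * Δ) a b := by
    intro a b
    rw [Fintype.sum_of_injective (Subtype.val : G.Edge → V × V) Subtype.val_injective _
      (fun e : V × V => (if e.2 = b then K a e.1 else 0) * Δ e.1 e.2) ?_ fun _ => rfl,
      Fintype.sum_prod_type, mul_apply]
    · simp
    · intro e he
      have : ¬ G.dir e.1 e.2 := fun h' => he ⟨⟨e, h'⟩, rfl⟩
      rw [hΔ _ _ this, mul_zero]
  rw [← hsum, ← hsum, ← Finset.sum_add_distrib]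
  refine Finset.sum_congr rfl fun d _ => ?_
  rw [← add_mul]
  congr 1
  exact if_pos ⟨hab, hadj⟩

theorem equationMatrix_apply_eq_zero {R : Type*} [CommRing R] (K : Matrix V V R) {a b : V}
    (h : ¬ (a ≠ b ∧ ¬ G.bi.Adj a b)) (d : G.Edge) : G.equationMatrix K (a, b) d = 0 :=
  if_neg h

/-- The linear span of the parameter space. -/
def paramSubmodule : Submodule ℝ (Matrix V V ℝ × Matrix V V ℝ) where
  carrier := {θ | (∀ v w, ¬ G.dir v w → θ.1 v w = 0) ∧ θ.2ᵀ = θ.2 ∧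
    ∀ v w, v ≠ w → ¬ G.bi.Adj v w → θ.2 v w = 0}
  zero_mem' := by simp
  add_mem' := by
    rintro a b ⟨h1, h2, h3⟩ ⟨h1', h2', h3'⟩
    exact ⟨fun v w h => by simp [h1 v w h, h1' v w h], by simp [h2, h2'],
      fun v w h h' => by simp [h3 v w h h', h3' v w h h']⟩
  smul_mem' := by
    rintro c a ⟨h1, h2, h3⟩
    exact ⟨fun v w h => by simp [h1 v w h], by simp [h2], fun v w h h' => by simp [h3 v w h h']⟩

/-- The restriction of a direction in the parameter space to the directed edges. -/
def edgeCoords : G.paramSubmodule →ₗ[ℝ] G.Edge → ℝ where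
  toFun v d := v.1.1 d.1.1 d.1.2
  map_add' _ _ := rfl
  map_smul' _ _ := rfl

variable [Fintype V] [DecidableEq V]

theorem mem_paramSubmodule {θ : Matrix V V ℝ × Matrix V V ℝ} (hθ : θ ∈ G.paramSpace) :
    θ ∈ G.paramSubmodule :=
  ⟨hθ.1.1, by simpa [conjTranspose_eq_transpose_of_trivial] using hθ.2.1.isHermitian.eq, hθ.2.2⟩

theorem contDiffAt_param {θ : Matrix V V ℝ × Matrix V V ℝ} (hθ : IsUnit (1 - θ.1)) :
    ContDiffAt ℝ 1 param θ := by
  have h1 : ContDiffAt ℝ 1 (fun θ : Matrix V V ℝ × Matrix V V ℝ => (1 - θ.1)⁻¹) θ := by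
    simp_rw [nonsing_inv_eq_ringInverse]
    have h2 : ContDiffAt ℝ 1 (fun θ : Matrix V V ℝ × Matrix V V ℝ => 1 - θ.1) θ := by fun_prop
    exact ContDiffAt.comp (g := Ring.inverse) θ (contDiffAt_ringInverse ℝ hθ.unit) h2
  have h3 : ContDiffAt ℝ 1 (fun θ : Matrix V V ℝ × Matrix V V ℝ => ((1 - θ.1)⁻¹)ᵀ) θ :=
    (transposeLinearEquiv V V ℝ ℝ).toLinearMap.toContinuousLinearMap.contDiff.contDiffAt.comp θ h1
  exact (h3.mul contDiffAt_snd).mul h1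

/-- The derivative of `(1 - Λ)⁻¹` is `(1 - Λ)⁻¹ Δ (1 - Λ)⁻¹`; symmetry of `Ω` makes the two terms in
`Δ` transposes of each other. -/
theorem fderiv_param_apply {θ : Matrix V V ℝ × Matrix V V ℝ} (hθ : IsUnit (1 - θ.1))
    (hsymm : θ.2ᵀ = θ.2) (v : Matrix V V ℝ × Matrix V V ℝ) :
    fderiv ℝ param θ v = ((1 - θ.1)⁻¹)ᵀ *
      ((θ.2 * (1 - θ.1)⁻¹ * v.1)ᵀ + v.2 + θ.2 * (1 - θ.1)⁻¹ * v.1) * (1 - θ.1)⁻¹ := by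
  have h0 : HasFDerivAt (fun θ : Matrix V V ℝ × Matrix V V ℝ => 1 - θ.1)
      (-ContinuousLinearMap.fst ℝ (Matrix V V ℝ) (Matrix V V ℝ)) θ := hasFDerivAt_fst.const_sub 1
  obtain ⟨D, hD, hDv⟩ : ∃ D : Matrix V V ℝ × Matrix V V ℝ →L[ℝ] Matrix V V ℝ,
      HasFDerivAt (fun θ : Matrix V V ℝ × Matrix V V ℝ => (1 - θ.1)⁻¹) D θ ∧
      ∀ v, D v = (1 - θ.1)⁻¹ * v.1 * (1 - θ.1)⁻¹ := by
    simp_rw [nonsing_inv_eq_ringInverse]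
    refine ⟨_, HasFDerivAt.comp (g := Ring.inverse) θ
      (hasFDerivAt_ringInverse (𝕜 := ℝ) hθ.unit) h0, fun v => ?_⟩
    have hinv : (↑(hθ.unit⁻¹) : Matrix V V ℝ) = Ring.inverse (1 - θ.1) := by
      rw [← nonsing_inv_eq_ringInverse, coe_units_inv, IsUnit.unit_spec]
    change -((↑(hθ.unit⁻¹) : Matrix V V ℝ) * (-v.1) * (↑(hθ.unit⁻¹) : Matrix V V ℝ)) = _
    rw [hinv, mul_neg, neg_mul, neg_neg]
  let T : Matrix V V ℝ →L[ℝ] Matrix V V ℝ :=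
    (transposeLinearEquiv V V ℝ ℝ).toLinearMap.toContinuousLinearMap
  have h3 : HasFDerivAt (fun θ : Matrix V V ℝ × Matrix V V ℝ => ((1 - θ.1)⁻¹)ᵀ)
      (T.comp D) θ := T.hasFDerivAt.comp θ hD
  have hT : ∀ A, T A = Aᵀ := fun _ => rfl
  have h4 := (h3.mul' (hasFDerivAt_snd (𝕜 := ℝ) (p := θ))).mul' hD
  have h5 : fderiv ℝ param θ = _ := h4.fderiv
  rw [h5]
  change ((1 - θ.1)⁻¹)ᵀ * θ.2 * D v +
    (((1 - θ.1)⁻¹)ᵀ * v.2 + T (D v) * θ.2) * (1 - θ.1)⁻¹ = _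
  rw [hT, hDv, transpose_mul, transpose_mul, transpose_mul, transpose_mul, hsymm]
  noncomm_ring

end MixedGraph

/-! ### Kernel dimension, its polynomial description, and the fibers -/

namespace MixedGraph

open Matrix Filter Topology
open scoped Matrix.Norms.Operator

variable {V : Type*} (G : MixedGraph V) [Fintype V] [DecidableEq V]

theorem isUnit_one_sub_eventually {θ : Matrix V V ℝ × Matrix V V ℝ} (hθ : IsUnit (1 - θ.1)) :
    ∀ᶠ η in 𝓝 θ, IsUnit (1 - η.1) := by
  have hc : ContinuousAt (fun η : Matrix V V ℝ × Matrix V V ℝ => 1 - η.1) θ := by fun_prop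
  exact hc.preimage_mem_nhds (Units.isOpen.mem_nhds hθ)

/-- The support conditions are built into `paramSubmodule`; invertibility and positive definiteness
are open there. -/
theorem paramSpace_mem_nhds (θ : G.paramSubmodule) (hθ : θ.1 ∈ G.paramSpace) :
    ∀ᶠ η in 𝓝 θ, η.1 ∈ G.paramSpace := by
  have hval : Tendsto (Subtype.val : G.paramSubmodule → _) (𝓝 θ) (𝓝 θ.1) :=
    continuous_subtype_val.tendsto θ
  have h2 : Tendsto (fun η : G.paramSubmodule => η.1.2) (𝓝 θ) (𝓝 θ.1.2) :=
    (continuous_snd.tendsto θ.1).comp hval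
  filter_upwards [hval.eventually (isUnit_one_sub_eventually hθ.1.2),
    h2.eventually hθ.2.1.eventually_nhds] with η hη hη'
  refine ⟨⟨η.2.1, hη⟩, hη' ?_, η.2.2.2⟩
  rw [IsHermitian, conjTranspose_eq_transpose_of_trivial, η.2.2.1]

theorem hasFDerivAt_param_restrict {θ : G.paramSubmodule} (hθ : IsUnit (1 - θ.1.1)) :
    HasFDerivAt (fun η : G.paramSubmodule => param η.1)
      ((fderiv ℝ param θ.1).comp G.paramSubmodule.subtypeL) θ :=
  ((contDiffAt_param hθ).differentiableAt one_ne_zero).hasFDerivAt.comp θ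
    G.paramSubmodule.subtypeL.hasFDerivAt

theorem mem_ker_fderiv_param_iff {θ : G.paramSubmodule} (hθ : IsUnit (1 - θ.1.1))
    (v : G.paramSubmodule) :
    fderiv ℝ (fun η : G.paramSubmodule => param η.1) θ v = 0 ↔
      (θ.1.2 * (1 - θ.1.1)⁻¹ * v.1.1)ᵀ + v.1.2 + θ.1.2 * (1 - θ.1.1)⁻¹ * v.1.1 = 0 := by
  rw [(G.hasFDerivAt_param_restrict hθ).fderiv]
  change fderiv ℝ param θ.1 v.1 = 0 ↔ _
  rw [fderiv_param_apply hθ θ.2.2.1]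
  have hM : IsUnit (1 - θ.1.1)⁻¹ := isUnit_nonsing_inv_iff.2 hθ
  have hMT : IsUnit ((1 - θ.1.1)⁻¹)ᵀ := (isUnit_transpose _).2 hM
  rw [hM.mul_left_eq_zero, hMT.mul_right_eq_zero]

/-- The kernel of the derivative of the parametrization has the same dimension as the kernel of the
equation matrix. -/
theorem finrank_ker_fderiv_param {θ : G.paramSubmodule} (hθ : IsUnit (1 - θ.1.1)) :
    Module.finrank ℝ (LinearMap.ker (fderiv ℝ (fun η : G.paramSubmodule => param η.1) θ :
      G.paramSubmodule →ₗ[ℝ] Matrix V V ℝ)) =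
    Module.finrank ℝ (LinearMap.ker
      (G.equationMatrix (θ.1.2 * (1 - θ.1.1)⁻¹)).mulVecLin) := by
  classical
  set L : G.paramSubmodule →ₗ[ℝ] Matrix V V ℝ :=
    (fderiv ℝ (fun η : G.paramSubmodule => param η.1) θ : G.paramSubmodule →ₗ[ℝ] Matrix V V ℝ)
  have hL : ∀ v, v ∈ LinearMap.ker L ↔ _ := fun v => G.mem_ker_fderiv_param_iff hθ v
  set K := θ.1.2 * (1 - θ.1.1)⁻¹ with hK
  have hinj : Function.Injective (G.edgeCoords ∘ₗ (LinearMap.ker L).subtype) := by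
    refine (injective_iff_map_eq_zero _).2 ?_
    rintro ⟨v, hv⟩ hv0
    have h1 : v.1.1 = 0 := by
      ext a b
      by_cases hab : G.dir a b
      · exact congrFun hv0 ⟨(a, b), hab⟩
      · exact v.2.1 a b hab
    have h2 := (hL v).1 hv
    rw [h1, mul_zero, transpose_zero, zero_add, add_zero] at h2
    exact Subtype.ext (Subtype.ext (Prod.ext h1 h2))
  have hrange : LinearMap.range (G.edgeCoords ∘ₗ (LinearMap.ker L).subtype) =
      LinearMap.ker (G.equationMatrix K).mulVecLin := by
    ext x
    constructor
    · rintro ⟨⟨v, hv⟩, rfl⟩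
      have h0 := (hL v).1 hv
      change G.equationMatrix K *ᵥ (fun d => v.1.1 d.1.1 d.1.2) = 0
      ext ⟨a, b⟩
      by_cases hab : a ≠ b ∧ ¬ G.bi.Adj a b
      · rw [equationMatrix_mulVec G K v.1.1 v.2.1 hab.1 hab.2]
        have h1 : (K * v.1.1) b a + v.1.2 a b + (K * v.1.1) a b = 0 :=
          congrFun (congrFun h0 a) b
        rw [v.2.2.2 a b hab.1 hab.2, add_zero] at h1
        rw [add_comm, h1]
        rfl
      · exact Finset.sum_eq_zero fun d _ =>
          mul_eq_zero_of_left (G.equationMatrix_apply_eq_zero K hab d) _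
    · intro hx
      let Δ : Matrix V V ℝ := of fun a b => if hab : G.dir a b then x ⟨(a, b), hab⟩ else 0
      have hΔ : ∀ a b, ¬ G.dir a b → Δ a b = 0 := fun a b hab => dif_neg hab
      have hΔx : (fun d : G.Edge => Δ d.1.1 d.1.2) = x := by
        ext d
        exact dif_pos d.2
      -- The `Ω`-component is forced by `Δ`, and the equations say that it has the right support.
      have hmem : (Δ, -((K * Δ)ᵀ + K * Δ)) ∈ G.paramSubmodule := by
        refine ⟨hΔ, ?_, fun a b hab hadj => ?_⟩
        · simp [add_comm]
        · have h1 := equationMatrix_mulVec G K Δ hΔ hab hadj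
          rw [hΔx] at h1
          have h2 : (G.equationMatrix K *ᵥ x) (a, b) = 0 := congrFun hx (a, b)
          rw [h2] at h1
          change -((K * Δ) b a + (K * Δ) a b) = 0
          rw [add_comm, ← h1, neg_zero]
      refine ⟨⟨⟨_, hmem⟩, (hL _).2 ?_⟩, hΔx⟩
      change (K * Δ)ᵀ + -((K * Δ)ᵀ + K * Δ) + K * Δ = 0
      abel
  rw [← LinearMap.finrank_range_of_inj hinj, hrange]

/-- Up to an invertible factor, the equation matrix has polynomial entries. -/
theorem ker_equationMatrix_adjugate {θ : Matrix V V ℝ × Matrix V V ℝ} (hθ : IsUnit (1 - θ.1)) :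
    LinearMap.ker (G.equationMatrix (θ.2 * (1 - θ.1).adjugate)).mulVecLin =
      LinearMap.ker (G.equationMatrix (θ.2 * (1 - θ.1)⁻¹)).mulVecLin := by
  have hd : (1 - θ.1).det ≠ 0 := ((isUnit_iff_isUnit_det _).1 hθ).ne_zero
  have h1 : θ.2 * (1 - θ.1)⁻¹ = (1 - θ.1).det⁻¹ • (θ.2 * (1 - θ.1).adjugate) := by
    rw [inv_def, Matrix.mul_smul, Ring.inverse_eq_inv']
  ext x
  rw [h1, equationMatrix_smul, LinearMap.mem_ker, LinearMap.mem_ker, mulVecLin_apply,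
    mulVecLin_apply, smul_mulVec, smul_eq_zero_iff_right (inv_ne_zero hd)]

/-- Determinants of affine images of the equation matrix are polynomial functions of the
parameters. -/
theorem exists_eval_coords_eq_det (B : Matrix G.Edge (V × V) ℝ) (C : Matrix G.Edge G.Edge ℝ) :
    ∃ f : MvPolynomial ((V × V) ⊕ (V × V)) ℝ, ∀ θ : Matrix V V ℝ × Matrix V V ℝ,
      MvPolynomial.eval (coords θ) f =
        (B * G.equationMatrix (θ.2 * (1 - θ.1).adjugate) + C).det := by
  let Λ : Matrix V V (MvPolynomial ((V × V) ⊕ (V × V)) ℝ) :=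
    of fun a b => MvPolynomial.X (Sum.inl (a, b))
  let Ω : Matrix V V (MvPolynomial ((V × V) ⊕ (V × V)) ℝ) :=
    of fun a b => MvPolynomial.X (Sum.inr (a, b))
  let B' : Matrix G.Edge (V × V) (MvPolynomial ((V × V) ⊕ (V × V)) ℝ) := B.map MvPolynomial.C
  let C' : Matrix G.Edge G.Edge (MvPolynomial ((V × V) ⊕ (V × V)) ℝ) := C.map MvPolynomial.C
  refine ⟨(B' * G.equationMatrix (Ω * (1 - Λ).adjugate) + C').det, fun θ => ?_⟩
  set φ := MvPolynomial.eval (coords θ) with hφ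
  have hΛ : Λ.map φ = θ.1 := by
    ext a b
    simp [Λ, φ, coords]
  have hΩ : Ω.map φ = θ.2 := by
    ext a b
    simp [Ω, φ, coords]
  have hadj : ((1 - Λ).adjugate).map φ = (1 - θ.1).adjugate := by
    have := φ.map_adjugate (1 - Λ)
    rw [map_sub, map_one] at this
    simpa [hΛ] using this
  have hB : B'.map φ = B := by
    ext a b
    simp [B', φ]
  have hC : C'.map φ = C := by
    ext a b
    simp [C', φ]
  rw [φ.map_det, map_add]
  simp only [RingHom.mapMatrix_apply]
  rw [Matrix.map_mul, hB, equationMatrix_map, Matrix.map_mul, hΩ, hadj, hC]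

/-- The fiber is infinite at the points of the parameter space at which the kernel of the equation
matrix is nontrivial and of minimal dimension. -/
theorem fiber_infinite {θ : Matrix V V ℝ × Matrix V V ℝ} (hθ : θ ∈ G.paramSpace)
    (hmin : ∀ ξ ∈ G.paramSpace,
      Module.finrank ℝ (LinearMap.ker (G.equationMatrix (θ.2 * (1 - θ.1)⁻¹)).mulVecLin) ≤
      Module.finrank ℝ (LinearMap.ker (G.equationMatrix (ξ.2 * (1 - ξ.1)⁻¹)).mulVecLin))
    (hpos : ∃ x, x ≠ 0 ∧ G.equationMatrix (θ.2 * (1 - θ.1)⁻¹) *ᵥ x = 0) :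
    (G.fiber θ).Infinite := by
  let η : G.paramSubmodule := ⟨θ, G.mem_paramSubmodule hθ⟩
  have hnhds := G.paramSpace_mem_nhds η hθ
  have hinf := infinite_fiber_of_finrank_ker_le
    (f := fun η : G.paramSubmodule => param η.1) (x := η)
    ((contDiffAt_param hθ.1.2).comp η G.paramSubmodule.subtypeL.contDiff.contDiffAt)
    (by
      filter_upwards [hnhds] with ξ hξ
      exact ((G.finrank_ker_fderiv_param (θ := η) hθ.1.2).le.trans (hmin _ hξ)).trans
        (G.finrank_ker_fderiv_param hξ.1.2).ge)
    (by
      intro hbot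
      have h0 := (G.finrank_ker_fderiv_param (θ := η) hθ.1.2).symm.trans
        (Submodule.finrank_eq_zero.2 hbot)
      obtain ⟨x, hx, hx0⟩ := hpos
      have h1 : x ∈ LinearMap.ker (G.equationMatrix (θ.2 * (1 - θ.1)⁻¹)).mulVecLin := hx0
      rw [Submodule.finrank_eq_zero.1 h0] at h1
      exact hx h1)
    hnhds
  refine (hinf.image Subtype.val_injective.injOn).mono ?_
  rintro _ ⟨ξ, ⟨hξ, hξ'⟩, rfl⟩
  exact ⟨hξ, hξ'⟩

end MixedGraph

/-! ### The exceptional algebraic subset -/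

theorem theorem2 {V : Type*} [Fintype V] [DecidableEq V] (G : MixedGraph V)
    (h : ∀ Y : V → Set V,
      (∃ v, ¬ G.HalfTrekCriterion (Y v) v) ∨ (∃ v w, v ∈ Y w ∧ w ∈ Y v)) :
    G.GenericallyInfiniteToOne := by
  -- The adjugate replaces the inverse to keep the entries polynomial, without changing the kernel
  -- on `Θ`.
  let J : Matrix V V ℝ × Matrix V V ℝ → Matrix (V × V) G.Edge ℝ :=
    fun θ => G.equationMatrix (θ.2 * (1 - θ.1).adjugate)
  let k : Matrix V V ℝ × Matrix V V ℝ → ℕ :=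
    fun θ => Module.finrank ℝ (LinearMap.ker (J θ).mulVecLin)
  have hne : ((0 : Matrix V V ℝ), (1 : Matrix V V ℝ)) ∈ G.paramSpace := by
    refine ⟨⟨by simp, by simp⟩, Matrix.PosDef.one, fun v w hvw _ => ?_⟩
    simp [hvw]
  obtain ⟨θ₀, hθ₀, hmin⟩ := (InvImage.wf k wellFounded_lt).has_min G.paramSpace ⟨_, hne⟩
  have hmin' : ∀ θ ∈ G.paramSpace, k θ₀ ≤ k θ := fun θ hθ => not_lt.1 (hmin θ hθ)
  obtain ⟨B, C, hBC, hle⟩ := Matrix.exists_det_ne_zero_imp_finrank_ker_le (J θ₀)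
  obtain ⟨f, hf⟩ := G.exists_eval_coords_eq_det B C
  refine ⟨{θ ∈ G.paramSpace | ∀ g ∈ ({f} : Set (MvPolynomial ((V × V) ⊕ (V × V)) ℝ)),
    MvPolynomial.eval (MixedGraph.coords θ) g = 0}, ⟨{f}, rfl⟩, ?_, ?_⟩
  -- The minimizer `θ₀` itself lies outside the zero set of `f`.
  · refine ⟨fun θ hθ => hθ.1, fun hsub => hBC ?_⟩
    exact (hf θ₀).symm.trans ((hsub hθ₀).2 f rfl)
  · rintro θ ⟨hθ, hθZ⟩
    have hdet : (B * J θ + C).det ≠ 0 := by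
      intro h0
      refine hθZ ⟨hθ, ?_⟩
      rintro g rfl
      exact (hf θ).trans h0
    refine G.fiber_infinite hθ (fun ξ hξ => ?_) (G.exists_equationMatrix_mulVec_eq_zero h hθ)
    rw [← G.ker_equationMatrix_adjugate hθ.1.2, ← G.ker_equationMatrix_adjugate hξ.1.2]
    exact (hle _ hdet).trans (hmin' ξ hξ)
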